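/- **Theorem B.1 (risk bound with unknown noise variance).** Let $1\le s<p$ and $n\ge 1$ be integers and consider the Gaussian sequence model $Y_i=\theta_i+\varepsilon_i$, $\varepsilon_i\overset{\text{i.i.d.}}{\sim}N(0,\sigma^2/n)$, $i=1,\dots,p$, with $\theta$ and $\sigma^2>0$ unknown. For $R>0$ let $$\Theta_\downarrow(s,R)=\{\theta\in\mathbb R^p:\ \exists k\le s,\ \theta_1^2\ge\dots\ge\theta_k^2\ge0,\ \theta_1^2\le R,\ \theta_i=0\text{ for }i>k\}.$$ Estimate the noise variance from the tail coordinates, $$\hat\sigma^2=\frac{n}{p-s}\sum_{i=s+1}^pY_i^2,\qquad \hat\lambda=\hat\sigma^2/n,$$ put $X_i=Y_i^2-\hat\lambda$ for $i\le s$, and split $\{1,\dots,s\}$ into $I_1$ (odd indices) and $I_2$ (even indices). For $a\in\{1,2\}$ let $\widehat V^{(-a)}$ be an isotonic least squares fit on the opposite fold, i.e. a nonincreasing sequence $\widehat V^{(-a)}_1\ge\dots\ge\widehat V^{(-a)}_s$ minimizing $$\sum_{i\in I_{3-a}}(X_i-v_i)^2\quad\text{over all real } v_1\ge\dots\ge v_s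 .$$ This criterion determines $\widehat V^{(-a)}_i$ only for $i\in I_{3-a}$; for $i\in I_a$ the largest value allowed by monotonicity is taken, that is $\widehat V^{(-a)}_i=\widehat V^{(-a)}_{i-1}$ for $i\in I_a$, $i\ge2$, while $\widehat V^{(-1)}_1$, which monotonicity does not bound from above, may be any (possibly data-dependent) value in $[R,+\infty]$ that is at least $\widehat V^{(-1)}_2$ (if $s\ge 2$); for instance it may be $+\infty$, in which case the first coordinate is not shrunk. Let $$\widehat\theta_i=\frac{(\widehat V_i^{(-a)})_+}{(\widehat V_i^{(-a)})_++\hat\lambda}\,Y_i\quad(i\in I_a,\ a=1,2),\qquad \widehat\theta_i=0\quad(i>s),$$ where the factor is $1$ when $\widehat V_i^{(-a)}=+\infty$. Then there is a universal constant $C>0$ such that, for all such $p,s,n$, all $\sigma>0$, all $R\ge\sigma^2/n$ and all such estimators, $$\sup_{\theta\in\Theta_\downarrow(s,R)}\mathbb E_\theta\|\widehat\theta-\theta\|_2^2\ \le\ C\,s\,\frac{\sigma^2}{n}\log\Big(\frac{ep}{s}\Big)\log\Big(1+\frac{Rn}{\sigma^2}\Big)+C\Big(\frac{\sigma^2}{n}+\frac{sR}{p-s}\Big).$$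 -/

import Mathlib

open MeasureTheory ProbabilityTheory

noncomputable section

/-- The sparse ordered class `Θ↓(s, R)` in `ℝ^p`; coordinate `i` of the text is `⟨i - 1, _⟩ : Fin p`. -/
def sparseOrderedClass (p s : ℕ) (R : ℝ) : Set (Fin p → ℝ) :=
  {θ | ∃ k ≤ s,
    (∀ i j : Fin p, i ≤ j → j.val < k → (θ j) ^ 2 ≤ (θ i) ^ 2) ∧
    (∀ i : Fin p, i.val = 0 → (θ i) ^ 2 ≤ R) ∧
    (∀ i : Fin p, k ≤ i.val → θ i = 0)}

/-- The law of `Y = θ + ε` with `ε` i.i.d. `N(0, σ² / n)`. -/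
def sequenceModel {p : ℕ} (n : ℕ) (σ : ℝ) (θ : Fin p → ℝ) : Measure (Fin p → ℝ) :=
  Measure.pi fun i => gaussianReal (θ i) (Real.toNNReal (σ ^ 2 / n))

/-- Tail estimator of the noise variance `σ²`. -/
def sigmaSqHat {p : ℕ} (n s : ℕ) (y : Fin p → ℝ) : ℝ :=
  (n : ℝ) / ((p : ℝ) - (s : ℝ)) * ∑ i with s ≤ i.val, (y i) ^ 2

/-- `λ̂ = σ̂² / n`. -/
def lambdaHat {p : ℕ} (n s : ℕ) (y : Fin p → ℝ) : ℝ :=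
  sigmaSqHat n s y / n

/-- The variance proxies `X_i = Y_i² - λ̂` (only those with `i.val < s` are used). -/
def varianceProxy {p : ℕ} (n s : ℕ) (y : Fin p → ℝ) (i : Fin p) : ℝ :=
  (y i) ^ 2 - lambdaHat n s y

/-- The fold of odd positions among the first `s` (positions are `i.val + 1`). -/
def oddFold (p s : ℕ) : Finset (Fin p) := {i | i.val < s ∧ Odd (i.val + 1)}

/-- The fold of even positions among the first `s` (positions are `i.val + 1`). -/
def evenFold (p s : ℕ) : Finset (Fin p) := {i | i.val < s ∧ Even (i.val + 1)}

/-- `v` is a nonincreasing sequence on the first `s` positions that minimizes the sum of squares over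
the fold `I` among all nonincreasing real sequences. It is real-valued on `I`; outside `I`, where the
criterion does not see it, the value `⊤` is allowed as well. -/
def IsIsotonicFit {p : ℕ} (s : ℕ) (I : Finset (Fin p)) (x : Fin p → ℝ) (v : Fin p → EReal) : Prop :=
  AntitoneOn v {i | i.val < s} ∧
  (∀ i ∈ I, v i ≠ ⊤ ∧ v i ≠ ⊥) ∧
  ∀ u : Fin p → ℝ, AntitoneOn u {i | i.val < s} →
    ∑ i ∈ I, (x i - (v i).toReal) ^ 2 ≤ ∑ i ∈ I, (x i - u i) ^ 2

/-- The convention for the coordinates outside the fold `I`, which the criterion leaves undetermined: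
such a coordinate takes the largest value that monotonicity allows, namely the value at the preceding
position. If the very first position is outside `I`, monotonicity gives no upper bound, and any
value in `[R, ⊤]` is allowed there. -/
def IsUpperExtension {p : ℕ} (s : ℕ) (I : Finset (Fin p)) (R : ℝ) (v : Fin p → EReal) : Prop :=
  ∀ i : Fin p, i.val < s → i ∉ I →
    (i.val = 0 → (R : EReal) ≤ v i) ∧ (∀ j : Fin p, j.val + 1 = i.val → v i = v j)

/-- The shrinkage factor `v₊ / (v₊ + lam)`, equal to `1` at `v = ⊤`. -/
def shrinkFactor (v : EReal) (lam : ℝ) : ℝ :=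
  if v = ⊤ then 1 else max v.toReal 0 / (max v.toReal 0 + lam)

/-- The cross-fit shrinkage estimator: `v₁` (fitted on the even fold) is used at odd positions, `v₂`
(fitted on the odd fold) at even positions, and the coordinates beyond `s` are set to zero. -/
def crossFitEstimator {p : ℕ} (n s : ℕ) (v₁ v₂ : (Fin p → ℝ) → Fin p → EReal)
    (y : Fin p → ℝ) (i : Fin p) : ℝ :=
  if i ∈ oddFold p s then shrinkFactor (v₁ y i) (lambdaHat n s y) * y i
  else if i ∈ evenFold p s then shrinkFactor (v₂ y i) (lambdaHat n s y) * y i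
  else 0

end

/-!
The risk bound holds because isotonic regression on a nonincreasing signal essentially never
underestimates. Write `lam = σ ^ 2 / n` for the noise level. A coordinate shrunk by a factor
`c ∈ [0, 1]` has squared error at most `(y - θ) ^ 2 + (1 - c) * θ ^ 2`, whatever data `c` depends on,
and the first term has expectation `lam`. Only the bias `(1 - c) * θ ^ 2` has to be controlled. If
the proxy is at least `θ ^ 2 / 4`, the bias is at most four times the variance estimate
(`one_sub_shrinkFactor_mul_le`), whose expectation is `lam`, as the signal vanishes beyond `s`
(`lintegral_lambdaHat`).

A proxy is inherited from the fitted value at a fold position `j` just before the coordinate. By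
the max-min formula, that value is at least the average of the variance proxies over some window of
the fold ending at `j` (`IsIsotonicFit.exists_window`). Every signal value on this window has square
at least `θ j ^ 2`, so a fitted value below `θ j ^ 2 / 4` forces the noise energy on the window to
exceed `θ j ^ 2 / 12` times its size, unless the variance estimate is itself of order `θ j ^ 2`
(`one_sub_shrinkFactor_mul_sq_le`). A window of size `m` does this with probability at most
`(√2 * exp (-θ j ^ 2 / (48 * lam))) ^ m`. Windows ending at `j` have distinct sizes, so a geometric
series bounds the total, and the exponential beats the factor `θ j ^ 2`
(`mul_lintegral_windowPenalty_le`). The first coordinate has a proxy of at least `R`, hence a small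
bias as well.

Each of the `s` coordinates therefore costs a constant times `lam`
(`lintegral_crossFitEstimator_le`). This is at most the claimed bound, because `log (e p / s) ≥ 1`
and `log (1 + R n / σ ^ 2) ≥ log 2`, the latter by `R ≥ lam`. The cross-fitting is used only through
the inheritance of proxies, not through independence, and the fits are not assumed measurable: the
loss is bounded pointwise by a measurable majorant.
-/

/-! ### Windows of the isotonic fit -/

/-- The part of the fold `I` between the positions `a` and `j`, both included. -/
def foldWindow {p : ℕ} (I : Finset (Fin p)) (a j : Fin p) : Finset (Fin p) :=
  {i ∈ I | a ≤ i ∧ i ≤ j}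

/-- Replacing infinite values off the fold by finite ones turns an isotonic fit into a real
nonincreasing sequence with the same values on the fold. -/
lemma IsIsotonicFit.exists_real {p s : ℕ} {I : Finset (Fin p)} {x : Fin p → ℝ}
    {v : Fin p → EReal} (h : IsIsotonicFit s I x v) :
    ∃ w : Fin p → ℝ, AntitoneOn w {i | i.val < s} ∧ ∀ i ∈ I, w i = (v i).toReal := by
  set B : ℝ := ∑ i ∈ I, |(v i).toReal| with hB
  refine ⟨fun i => (max (min (v i) (B : EReal)) ((-B : ℝ) : EReal)).toReal, ?_, ?_⟩
  · intro i hi k hk hik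
    refine EReal.toReal_le_toReal (max_le_max_right _ (min_le_min_right _ (h.1 hi hk hik))) ?_ ?_
    · exact ne_bot_of_le_ne_bot (EReal.coe_ne_bot (-B)) (le_max_right _ _)
    · refine (max_lt (lt_of_le_of_lt (min_le_right _ _) (EReal.coe_lt_top _))
        (EReal.coe_lt_top _)).ne
  · intro i hi
    obtain ⟨h1, h2⟩ := h.2.1 i hi
    have hb : |(v i).toReal| ≤ B :=
      Finset.single_le_sum (f := fun i => |(v i).toReal|) (fun _ _ => abs_nonneg _) hi
    rw [abs_le] at hb
    have e : v i = ((v i).toReal : EReal) := (EReal.coe_toReal h1 h2).symm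
    have l1 : v i ≤ (B : EReal) := by rw [e]; exact_mod_cast hb.2
    have l2 : ((-B : ℝ) : EReal) ≤ v i := by rw [e]; exact_mod_cast hb.1
    simp only [min_eq_left l1, max_eq_left l2]

/-- The lower half of the max-min formula for isotonic regression: some window of the fold that
ends at `j` has an average of at most the fitted value at `j`. The window is the part up to `j` of
the level block of `j`; raising the fit on it would otherwise improve the criterion. -/
lemma IsIsotonicFit.exists_window {p s : ℕ} {I : Finset (Fin p)} {x : Fin p → ℝ}
    {v : Fin p → EReal} (h : IsIsotonicFit s I x v) (hI : ∀ i ∈ I, i.val < s)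
    {j : Fin p} (hj : j ∈ I) :
    ∃ a ∈ I, a ≤ j ∧
      ∑ i ∈ foldWindow I a j, x i ≤ (foldWindow I a j).card * (v j).toReal := by
  obtain ⟨w, hw, hwv⟩ := h.exists_real
  set L : Finset (Fin p) := {i ∈ I | i ≤ j ∧ w i = w j} with hL
  have hjL : j ∈ L := by simp [hL, hj]
  have hne : L.Nonempty := ⟨j, hjL⟩
  set a := L.min' hne with ha
  have haL : a ∈ L := L.min'_mem hne
  have haL' := haL
  simp only [hL, Finset.mem_filter] at haL'
  obtain ⟨haI, haj, hwa⟩ := haL'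
  have hwin : foldWindow I a j = L := by
    ext i
    simp only [foldWindow, hL, Finset.mem_filter]
    constructor
    · rintro ⟨hi, h1, h2⟩
      refine ⟨hi, h2, le_antisymm ?_ (hw (hI i hi) (hI j hj) h2)⟩
      exact (hw (hI a haI) (hI i hi) h1).trans hwa.le
    · rintro ⟨hi, h1, h2⟩
      exact ⟨hi, L.min'_le i (by simp [hL, hi, h1, h2]), h1⟩
  refine ⟨a, haI, haj, ?_⟩
  rw [hwin, ← hwv j hj]
  -- A perturbation smaller than all gaps above `w j` only moves the block `L`.
  have hgap : ∀ᶠ ε in nhdsWithin (0 : ℝ) (Set.Ioi 0), ∀ i ∈ I, w j < w i → w j + ε ≤ w i := by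
    rw [Filter.eventually_all_finset]
    intro i _
    by_cases hlt : w j < w i
    · filter_upwards [Ioo_mem_nhdsGT (sub_pos.2 hlt)] with ε hε _
      linarith [hε.2]
    · exact Filter.Eventually.of_forall fun ε h' => absurd h' hlt
  have key : ∀ᶠ ε in nhdsWithin (0 : ℝ) (Set.Ioi 0),
      ∑ i ∈ L, x i ≤ L.card * w j + ε * (L.card / 2) := by
    filter_upwards [hgap, self_mem_nhdsWithin] with ε hε hpos
    have hpos : 0 < ε := hpos
    have hmin := h.2.2 (fun i => if i ≤ j then max (w i) (w j + ε) else w i) ?_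
    · have e1 : ∑ i ∈ I, (x i - (v i).toReal) ^ 2 = ∑ i ∈ I, (x i - w i) ^ 2 :=
        Finset.sum_congr rfl fun i hi => by rw [hwv i hi]
      rw [e1, ← sub_nonneg, ← Finset.sum_sub_distrib] at hmin
      have e2 : ∑ i ∈ I, ((x i - (if i ≤ j then max (w i) (w j + ε) else w i)) ^ 2
            - (x i - w i) ^ 2)
          = ∑ i ∈ L, (ε ^ 2 + 2 * ε * w j - 2 * ε * x i) := by
        rw [hL, ← Finset.filter_filter, Finset.sum_filter, Finset.sum_filter]
        refine Finset.sum_congr rfl fun i hi => ?_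
        split_ifs with h1 h2
        · rw [h2, max_eq_right (by linarith)]; ring
        · have : w j < w i := lt_of_le_of_ne (hw (hI i hi) (hI j hj) h1) (Ne.symm h2)
          rw [max_eq_left (hε i hi this)]; ring
        · ring
      rw [e2, Finset.sum_sub_distrib, ← Finset.mul_sum, Finset.sum_const, nsmul_eq_mul] at hmin
      have : 0 ≤ 2 * ε * (L.card * w j + ε * (L.card / 2) - ∑ i ∈ L, x i) := by
        linarith [hmin]
      have := nonneg_of_mul_nonneg_right this (by positivity)
      linarith
    · intro i hi k hk hik
      have hik' := hw hi hk hik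
      by_cases hkj : k ≤ j
      · simp only [hkj, hik.trans hkj, if_true]
        exact max_le_max_right _ hik'
      · simp only [hkj, if_false]
        split_ifs
        · exact hik'.trans (le_max_left _ _)
        · exact hik'
  have hlim : Filter.Tendsto (fun ε : ℝ => L.card * w j + ε * (L.card / 2))
      (nhdsWithin 0 (Set.Ioi 0)) (nhds (L.card * w j + 0 * (L.card / 2))) :=
    (Continuous.tendsto (by fun_prop) 0).mono_left nhdsWithin_le_nhds
  simpa using ge_of_tendsto hlim key

/-- If the observations are small on a window where the signal is not, then the noise is large. -/
lemma card_mul_le_sum_sq_sub {ι : Type*} {L : Finset ι} {y θ : ι → ℝ} {V : ℝ}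
    (hV : ∀ i ∈ L, V ≤ θ i ^ 2) (hy : ∑ i ∈ L, y i ^ 2 ≤ L.card * (V / 2)) :
    L.card * (V / 12) ≤ ∑ i ∈ L, (y i - θ i) ^ 2 := by
  have h : ∑ i ∈ L, V ≤ ∑ i ∈ L, (3 / 2 * y i ^ 2 + 3 * (y i - θ i) ^ 2) :=
    Finset.sum_le_sum fun i hi => (hV i hi).trans (by nlinarith [sq_nonneg (3 * y i - 2 * θ i)])
  rw [Finset.sum_add_distrib, ← Finset.mul_sum, ← Finset.mul_sum, Finset.sum_const,
    nsmul_eq_mul] at h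
  linarith

/-! ### Pointwise bounds for the loss -/

lemma shrinkFactor_nonneg (v : EReal) {lam : ℝ} (h : 0 ≤ lam) : 0 ≤ shrinkFactor v lam := by
  unfold shrinkFactor
  split_ifs <;> positivity

lemma shrinkFactor_le_one (v : EReal) {lam : ℝ} (h : 0 ≤ lam) : shrinkFactor v lam ≤ 1 := by
  unfold shrinkFactor
  split_ifs
  · exact le_rfl
  · exact div_le_one_of_le₀ (by linarith) (by positivity)

/-- Shrinking with a proxy that is not much smaller than `V` costs a bias of order `lam`. -/
lemma one_sub_shrinkFactor_mul_le {v : EReal} {lam V : ℝ} (h : 0 ≤ lam) (hV : 0 ≤ V)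
    (hv : ((V / 4 : ℝ) : EReal) ≤ v) : (1 - shrinkFactor v lam) * V ≤ 4 * lam := by
  unfold shrinkFactor
  split_ifs with ht
  · simpa using h
  · have hv' : V / 4 ≤ v.toReal := by
      simpa using EReal.toReal_le_toReal hv (EReal.coe_ne_bot _) ht
    have hm : V / 4 ≤ max v.toReal 0 := hv'.trans (le_max_left _ _)
    set m := max v.toReal 0
    rcases hV.eq_or_lt with rfl | hV
    · simpa using h
    have hpos : 0 < m + lam := by linarith
    rw [one_sub_div hpos.ne', div_mul_eq_mul_div, div_le_iff₀ hpos]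
    nlinarith

lemma shrink_sq_error_le {c : ℝ} (h0 : 0 ≤ c) (h1 : c ≤ 1) (y θ : ℝ) :
    (c * y - θ) ^ 2 ≤ (y - θ) ^ 2 + (1 - c) * θ ^ 2 := by
  nlinarith [mul_nonneg (mul_nonneg h0 (sub_nonneg.2 h1)) (sq_nonneg y),
    mul_nonneg (sub_nonneg.2 h1) (sq_nonneg (y - θ))]

/-- An exponential majorant of the indicator that the noise is large, in the sense of
`card_mul_le_sum_sq_sub`, on some window of `I` ending at `j`. -/
noncomputable def windowPenalty {p : ℕ} (I : Finset (Fin p)) (j : Fin p) (V lam : ℝ)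
    (θ y : Fin p → ℝ) : ℝ :=
  ∑ a ∈ I with a ≤ j, Real.exp
    ((∑ i ∈ foldWindow I a j, (y i - θ i) ^ 2 - (foldWindow I a j).card * (V / 12)) / (4 * lam))

lemma windowPenalty_nonneg {p : ℕ} (I : Finset (Fin p)) (j : Fin p) (V lam : ℝ)
    (θ y : Fin p → ℝ) : 0 ≤ windowPenalty I j V lam θ y :=
  Finset.sum_nonneg fun _ _ => (Real.exp_pos _).le

lemma lambdaHat_nonneg {p s : ℕ} (n : ℕ) (hsp : s < p) (y : Fin p → ℝ) :
    0 ≤ lambdaHat n s y := by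
  have : (0 : ℝ) < (p : ℝ) - s := sub_pos.2 (by exact_mod_cast hsp)
  unfold lambdaHat sigmaSqHat
  positivity

/-- If the fitted value at `j` is below a quarter of `θ j ^ 2`, then either the variance estimate
is of that order as well, or the noise is large on a window ending at `j`. -/
lemma one_sub_shrinkFactor_mul_sq_le {p s n : ℕ} {I : Finset (Fin p)} {θ y : Fin p → ℝ}
    {v : Fin p → EReal} {lam : ℝ} (hlam : 0 < lam) (hsp : s < p)
    (hθ : Antitone fun i => θ i ^ 2)
    (h : IsIsotonicFit s I (varianceProxy n s y) v) (hI : ∀ i ∈ I, i.val < s)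
    {i j : Fin p} (hj : j ∈ I) (hji : j ≤ i) :
    (1 - shrinkFactor (v j) (lambdaHat n s y)) * θ i ^ 2 ≤
      4 * lambdaHat n s y + θ j ^ 2 * windowPenalty I j (θ j ^ 2) lam θ y := by
  have hl := lambdaHat_nonneg n hsp y
  have hc0 := shrinkFactor_nonneg (v j) hl
  have hc1 := shrinkFactor_le_one (v j) hl
  have hpen := mul_nonneg (sq_nonneg (θ j)) (windowPenalty_nonneg I j (θ j ^ 2) lam θ y)
  have hmono : (1 - shrinkFactor (v j) (lambdaHat n s y)) * θ i ^ 2 ≤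
      (1 - shrinkFactor (v j) (lambdaHat n s y)) * θ j ^ 2 :=
    mul_le_mul_of_nonneg_left (hθ hji) (by linarith)
  have htriv : (1 - shrinkFactor (v j) (lambdaHat n s y)) * θ j ^ 2 ≤ θ j ^ 2 :=
    mul_le_of_le_one_left (sq_nonneg _) (by linarith)
  refine hmono.trans ?_
  by_cases h1 : θ j ^ 2 / 4 ≤ lambdaHat n s y
  · linarith
  by_cases h2 : ((θ j ^ 2 / 4 : ℝ) : EReal) ≤ v j
  · linarith [one_sub_shrinkFactor_mul_le hl (sq_nonneg (θ j)) h2]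
  obtain ⟨ht, hb⟩ := h.2.1 j hj
  have h2' : (v j).toReal < θ j ^ 2 / 4 := by
    rw [← EReal.coe_toReal ht hb] at h2
    exact_mod_cast not_le.1 h2
  obtain ⟨a, haI, haj, hsum⟩ := h.exists_window hI hj
  simp only [varianceProxy, Finset.sum_sub_distrib, Finset.sum_const, nsmul_eq_mul] at hsum
  have hnoise := card_mul_le_sum_sq_sub (L := foldWindow I a j) (y := y) (θ := θ)
    (V := θ j ^ 2) (fun k hk => hθ (by
      simp only [foldWindow, Finset.mem_filter] at hk; exact hk.2.2)) (by
      have : ((foldWindow I a j).card : ℝ) * ((v j).toReal + lambdaHat n s y) ≤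
          (foldWindow I a j).card * (θ j ^ 2 / 2) :=
        mul_le_mul_of_nonneg_left (by linarith) (Nat.cast_nonneg _)
      linarith)
  have hone : 1 ≤ windowPenalty I j (θ j ^ 2) lam θ y := by
    refine le_trans ?_ (Finset.single_le_sum (f := fun a => Real.exp
      ((∑ i ∈ foldWindow I a j, (y i - θ i) ^ 2
        - (foldWindow I a j).card * (θ j ^ 2 / 12)) / (4 * lam)))
      (fun _ _ => (Real.exp_pos _).le) (Finset.mem_filter.2 ⟨haI, haj⟩))
    rw [Real.one_le_exp_iff]
    exact div_nonneg (by linarith) (by positivity)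
  nlinarith [mul_le_mul_of_nonneg_left hone (sq_nonneg (θ j))]

/-! ### Gaussian moments -/

lemma lintegral_sq_sub_gaussianReal (μ : ℝ) (v : NNReal) :
    ∫⁻ x, ENNReal.ofReal ((x - μ) ^ 2) ∂(gaussianReal μ v) = v := by
  have h := evariance_eq_lintegral_ofReal (X := id) (μ := gaussianReal μ v)
  rw [← ofReal_variance (memLp_id_gaussianReal' 2 (by simp)), variance_id_gaussianReal] at h
  simpa using h.symm

/-- Tilting the centred Gaussian density of variance `v` by `exp (x ^ 2 / (4 v))` gives `√2` times
the density of variance `2 v`. -/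
lemma lintegral_exp_sq_sub_gaussianReal (μ : ℝ) {v : NNReal} (hv : v ≠ 0) :
    ∫⁻ x, ENNReal.ofReal (Real.exp ((x - μ) ^ 2 / (4 * v))) ∂(gaussianReal μ v) =
      ENNReal.ofReal (√2) := by
  have hv' : (0 : ℝ) < v := by positivity
  rw [gaussianReal_of_var_ne_zero μ hv, lintegral_withDensity_eq_lintegral_mul _
    (measurable_gaussianPDF μ v) (by fun_prop)]
  have e : ∀ x, (gaussianPDF μ v * fun x => ENNReal.ofReal (Real.exp ((x - μ) ^ 2 / (4 * v)))) x =
      ENNReal.ofReal (√2) * gaussianPDF μ (2 * v) x := by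
    intro x
    simp only [Pi.mul_apply, gaussianPDF]
    rw [← ENNReal.ofReal_mul (gaussianPDFReal_nonneg _ _ _), ← ENNReal.ofReal_mul (by positivity)]
    congr 1
    simp only [gaussianPDFReal, NNReal.coe_mul, NNReal.coe_ofNat]
    rw [mul_assoc, ← Real.exp_add, ← mul_assoc]
    congr 1
    · rw [show 2 * Real.pi * (2 * (v : ℝ)) = 2 * (2 * Real.pi * v) by ring,
        Real.sqrt_mul (by norm_num : (0 : ℝ) ≤ 2)]
      field_simp
    · congr 1
      field_simp
      ring
  simp_rw [e]
  rw [lintegral_const_mul _ (measurable_gaussianPDF _ _),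
    lintegral_gaussianPDF_eq_one μ (by simpa using hv), mul_one]

lemma toNNReal_var_ne_zero {n : ℕ} {σ : ℝ} (hn : 1 ≤ n) (hσ : 0 < σ) :
    Real.toNNReal (σ ^ 2 / n) ≠ 0 := by
  have : (0 : ℝ) < n := by exact_mod_cast hn
  exact (Real.toNNReal_pos.2 (by positivity)).ne'

lemma lintegral_sq_sub_sequenceModel {p : ℕ} (n : ℕ) (σ : ℝ) (θ : Fin p → ℝ) (i : Fin p) :
    ∫⁻ y, ENNReal.ofReal ((y i - θ i) ^ 2) ∂(sequenceModel n σ θ) =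
      ENNReal.ofReal (σ ^ 2 / n) := by
  have h := (measurePreserving_eval
    (fun i => gaussianReal (θ i) (Real.toNNReal (σ ^ 2 / n))) i).lintegral_comp
    (f := fun x => ENNReal.ofReal ((x - θ i) ^ 2)) (by fun_prop)
  rw [lintegral_sq_sub_gaussianReal] at h
  exact h

/-- The exponential moment of the noise energy on a set of coordinates. -/
lemma lintegral_exp_sum_sq_sub_sequenceModel {p n : ℕ} {σ : ℝ} (hn : 1 ≤ n) (hσ : 0 < σ)
    (θ : Fin p → ℝ) (L : Finset (Fin p)) :
    ∫⁻ y, ENNReal.ofReal (Real.exp ((∑ i ∈ L, (y i - θ i) ^ 2) / (4 * (σ ^ 2 / n))))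
      ∂(sequenceModel n σ θ) = ENNReal.ofReal (√2 ^ L.card) := by
  set ν : Fin p → Measure ℝ := fun i => gaussianReal (θ i) (Real.toNNReal (σ ^ 2 / n)) with hν
  have hvar : ((Real.toNNReal (σ ^ 2 / n) : NNReal) : ℝ) = σ ^ 2 / n :=
    Real.coe_toNNReal _ (by positivity)
  let f : Fin p → ℝ → ENNReal := fun i x =>
    ENNReal.ofReal (Real.exp ((x - θ i) ^ 2 / (4 * (σ ^ 2 / n))))
  have hf : ∀ i, Measurable (f i) := fun i => by fun_prop
  have e : ∀ y : Fin p → ℝ,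
      ENNReal.ofReal (Real.exp ((∑ i ∈ L, (y i - θ i) ^ 2) / (4 * (σ ^ 2 / n)))) =
        ∏ i ∈ L, f i (y i) := by
    intro y
    rw [Finset.sum_div, Real.exp_sum, ENNReal.ofReal_prod_of_nonneg fun _ _ => (Real.exp_pos _).le]
  simp_rw [e]
  have hind : iIndepFun (fun i (y : Fin p → ℝ) => f i (y i)) (Measure.pi ν) :=
    iIndepFun_pi fun i => (hf i).aemeasurable
  have hprod := lintegral_prod_eq_prod_lintegral_of_indepFun L _ hind
    (fun i => (hf i).comp (measurable_pi_apply i))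
  have hone : ∀ i, ∫⁻ y, f i (y i) ∂(Measure.pi ν) = ENNReal.ofReal (√2) := by
    intro i
    have h1 := (measurePreserving_eval ν i).lintegral_comp (hf i)
    have h2 := lintegral_exp_sq_sub_gaussianReal (θ i) (toNNReal_var_ne_zero hn hσ)
    rw [hvar] at h2
    exact h1.trans h2
  simp only [hone, Finset.prod_const] at hprod
  rw [ENNReal.ofReal_pow (by positivity)]
  exact hprod

/-! ### The expected window penalty -/

/-- Distinct left ends give windows of distinct sizes. -/
lemma card_foldWindow_injOn {p : ℕ} (I : Finset (Fin p)) (j : Fin p) :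
    Set.InjOn (fun a => (foldWindow I a j).card) {a | a ∈ I ∧ a ≤ j} := by
  have key : ∀ a b : Fin p, a ∈ I → a ≤ j → a < b →
      (foldWindow I b j).card < (foldWindow I a j).card := by
    intro a b ha haj hab
    refine Finset.card_lt_card ⟨fun i hi => ?_, fun hsub => ?_⟩
    · simp only [foldWindow, Finset.mem_filter] at hi ⊢
      exact ⟨hi.1, hab.le.trans hi.2.1, hi.2.2⟩
    · have : a ∈ foldWindow I b j := hsub (by simp [foldWindow, ha, haj])
      simp only [foldWindow, Finset.mem_filter] at this
      exact absurd this.2.1 (not_le.2 hab)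
  intro a ha b hb hab
  rcases lt_trichotomy a b with h | h | h
  · exact absurd hab (key a b ha.1 ha.2 h).ne'
  · exact h
  · exact absurd hab (key b a hb.1 hb.2 h).ne

/-- Windows that end at `j` have pairwise distinct positive sizes, so a geometric weight in the
size sums to at most the full geometric series. -/
lemma sum_pow_card_foldWindow_le {p : ℕ} (I : Finset (Fin p)) (j : Fin p) {q : ℝ} (h0 : 0 ≤ q)
    (h1 : q < 1) :
    ∑ a ∈ I with a ≤ j, q ^ (foldWindow I a j).card ≤ q / (1 - q) := by
  have hinj : Set.InjOn (fun a => (foldWindow I a j).card - 1)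
      (({a ∈ I | a ≤ j} : Finset (Fin p)) : Set (Fin p)) := by
    intro a ha b hb hab
    simp only [Finset.coe_filter, Set.mem_ofPred_eq] at ha hb
    refine card_foldWindow_injOn I j ha hb ?_
    have ha' : 0 < (foldWindow I a j).card :=
      Finset.card_pos.2 ⟨a, by simp [foldWindow, ha.1, ha.2]⟩
    have hb' : 0 < (foldWindow I b j).card :=
      Finset.card_pos.2 ⟨b, by simp [foldWindow, hb.1, hb.2]⟩
    simp only at hab ⊢
    omega
  have e : ∑ a ∈ I with a ≤ j, q ^ (foldWindow I a j).card =
      ∑ a ∈ I with a ≤ j, q * q ^ ((foldWindow I a j).card - 1) := by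
    refine Finset.sum_congr rfl fun a ha => ?_
    simp only [Finset.mem_filter] at ha
    have ha' : 0 < (foldWindow I a j).card :=
      Finset.card_pos.2 ⟨a, by simp [foldWindow, ha.1, ha.2]⟩
    rw [← pow_succ', Nat.sub_add_cancel ha']
  rw [e, ← Finset.mul_sum, ← Finset.sum_image (f := fun m => q ^ m) hinj, div_eq_mul_inv,
    ← tsum_geometric_of_lt_one h0 h1]
  exact mul_le_mul_of_nonneg_left ((summable_geometric_of_lt_one h0 h1).sum_le_tsum _
    fun _ _ => by positivity) h0

lemma measurable_windowPenalty {p : ℕ} (I : Finset (Fin p)) (j : Fin p) (V lam : ℝ)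
    (θ : Fin p → ℝ) : Measurable (windowPenalty I j V lam θ) := by
  unfold windowPenalty
  fun_prop

/-- With `x = V / (48 lam) ≥ 1` and `q = √2 * exp (-x)`, a window of size `m` contributes `q ^ m`;
the series is of order `exp (-x)`, which beats the factor `V`. -/
lemma mul_lintegral_windowPenalty_le {p n : ℕ} {σ : ℝ} (hn : 1 ≤ n) (hσ : 0 < σ)
    (θ : Fin p → ℝ) (I : Finset (Fin p)) (j : Fin p) {V : ℝ} (hV : 48 * (σ ^ 2 / n) ≤ V) :
    ∫⁻ y, ENNReal.ofReal (V * windowPenalty I j V (σ ^ 2 / n) θ y) ∂(sequenceModel n σ θ) ≤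
      ENNReal.ofReal (180 * (σ ^ 2 / n)) := by
  have hn' : (0 : ℝ) < n := by exact_mod_cast hn
  set lam := σ ^ 2 / n with hlam
  have hl : 0 < lam := by positivity
  have hV0 : 0 < V := by linarith
  set x := V / (48 * lam) with hx
  have hx1 : 1 ≤ x := by rw [hx, le_div_iff₀ (by positivity)]; linarith
  have hVx : V = 48 * lam * x := by rw [hx]; field_simp
  set q := √2 * Real.exp (-x) with hq
  have hs : √2 ≤ 3 / 2 := by
    rw [Real.sqrt_le_left (by norm_num)]; norm_num
  have hexp0 := Real.exp_pos (-x)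
  have hxe : x * Real.exp (-x) ≤ 2 / 5 := by
    -- `x * exp (-x) ≤ exp (-1)`.
    have h1 : x * Real.exp (-x) ≤ Real.exp (-1) := by
      have : x ≤ Real.exp (x - 1) := by linarith [Real.add_one_le_exp (x - 1)]
      calc x * Real.exp (-x) ≤ Real.exp (x - 1) * Real.exp (-x) :=
            mul_le_mul_of_nonneg_right this hexp0.le
        _ = Real.exp (-1) := by rw [← Real.exp_add]; congr 1; ring
    have h2 : Real.exp (-1) ≤ 2 / 5 := by linarith [Real.exp_neg_one_lt_d9]
    linarith
  have he : Real.exp (-x) ≤ 2 / 5 := by nlinarith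
  have hq0 : 0 ≤ q := by positivity
  have hqe : q ≤ 3 / 2 * Real.exp (-x) := mul_le_mul_of_nonneg_right hs hexp0.le
  have hq1 : q ≤ 3 / 5 := by linarith
  have hterm : ∀ a, ∫⁻ y, ENNReal.ofReal (Real.exp ((∑ i ∈ foldWindow I a j, (y i - θ i) ^ 2
      - (foldWindow I a j).card * (V / 12)) / (4 * lam))) ∂(sequenceModel n σ θ) =
      ENNReal.ofReal (q ^ (foldWindow I a j).card) := by
    intro a
    set m := (foldWindow I a j).card with hm
    have e : ∀ y : Fin p → ℝ, ENNReal.ofReal (Real.exp ((∑ i ∈ foldWindow I a j,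
        (y i - θ i) ^ 2 - m * (V / 12)) / (4 * lam))) =
        ENNReal.ofReal (Real.exp (-x) ^ m) *
          ENNReal.ofReal (Real.exp ((∑ i ∈ foldWindow I a j, (y i - θ i) ^ 2) / (4 * lam))) := by
      intro y
      rw [← ENNReal.ofReal_mul (by positivity), ← Real.exp_nat_mul, ← Real.exp_add]
      congr 2
      rw [hx]
      field_simp
      ring
    simp_rw [e]
    rw [lintegral_const_mul _ (by fun_prop), lintegral_exp_sum_sq_sub_sequenceModel hn hσ,
      ← ENNReal.ofReal_mul (by positivity), hq, mul_pow, mul_comm]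
  have hsum : ∫⁻ y, ENNReal.ofReal (windowPenalty I j V lam θ y) ∂(sequenceModel n σ θ) ≤
      ENNReal.ofReal (q / (1 - q)) := by
    simp_rw [windowPenalty, ENNReal.ofReal_sum_of_nonneg fun _ _ => (Real.exp_pos _).le]
    rw [lintegral_finsetSum _ fun a _ => by fun_prop]
    simp_rw [hterm]
    rw [← ENNReal.ofReal_sum_of_nonneg fun _ _ => by positivity]
    exact ENNReal.ofReal_le_ofReal (sum_pow_card_foldWindow_le I j hq0 (by linarith))
  simp_rw [ENNReal.ofReal_mul hV0.le]
  rw [lintegral_const_mul _ (measurable_windowPenalty I j V lam θ).ennreal_ofReal]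
  refine (mul_le_mul_right hsum _).trans ?_
  rw [← ENNReal.ofReal_mul hV0.le]
  refine ENNReal.ofReal_le_ofReal ?_
  have hgeo : q / (1 - q) ≤ 15 / 4 * Real.exp (-x) := by
    rw [div_le_iff₀ (by linarith)]
    nlinarith
  calc V * (q / (1 - q)) ≤ V * (15 / 4 * Real.exp (-x)) := mul_le_mul_of_nonneg_left hgeo hV0.le
    _ = 180 * lam * (x * Real.exp (-x)) := by rw [hVx]; ring
    _ ≤ 180 * lam := mul_le_of_le_one_right (by positivity) (by linarith)

/-- The variance estimate is unbiased, because `θ` vanishes beyond `s`. -/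
lemma lintegral_lambdaHat {p s n : ℕ} {σ : ℝ} (hsp : s < p) (hn : 1 ≤ n) {θ : Fin p → ℝ}
    (hθ : ∀ i : Fin p, s ≤ i.val → θ i = 0) :
    ∫⁻ y, ENNReal.ofReal (lambdaHat n s y) ∂(sequenceModel n σ θ) =
      ENNReal.ofReal (σ ^ 2 / n) := by
  have hn' : (0 : ℝ) < n := by exact_mod_cast hn
  have hps : (0 : ℝ) < (p : ℝ) - s := sub_pos.2 (by exact_mod_cast hsp)
  have e : ∀ y : Fin p → ℝ, ENNReal.ofReal (lambdaHat n s y) =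
      ENNReal.ofReal (1 / ((p : ℝ) - s)) *
        ∑ i : Fin p with s ≤ i.val, ENNReal.ofReal ((y i - θ i) ^ 2) := by
    intro y
    rw [← ENNReal.ofReal_sum_of_nonneg fun _ _ => sq_nonneg _, ← ENNReal.ofReal_mul (by positivity)]
    congr 1
    have : ∑ i : Fin p with s ≤ i.val, (y i - θ i) ^ 2 = ∑ i : Fin p with s ≤ i.val, y i ^ 2 :=
      Finset.sum_congr rfl fun i hi => by rw [hθ i (Finset.mem_filter.1 hi).2, sub_zero]
    rw [this, lambdaHat, sigmaSqHat]
    field_simp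
  have hcard : (Finset.univ.filter fun i : Fin p => s ≤ i.val).card = p - s := by
    have h1 := Fin.card_filter_val_lt (n := p) (m := s)
    have h2 := Finset.card_filter_add_card_filter_not (s := (Finset.univ : Finset (Fin p)))
      (fun i : Fin p => i.val < s)
    simp only [not_lt, Finset.card_univ, Fintype.card_fin] at h2
    omega
  simp_rw [e]
  rw [lintegral_const_mul _ (by fun_prop), lintegral_finsetSum _ fun a _ => by fun_prop]
  simp_rw [lintegral_sq_sub_sequenceModel]
  rw [Finset.sum_const, hcard, nsmul_eq_mul, ← ENNReal.ofReal_natCast, Nat.cast_sub hsp.le,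
    ← ENNReal.ofReal_mul hps.le, ← ENNReal.ofReal_mul (by positivity)]
  congr 1
  field_simp

/-! ### Risk of one coordinate -/

lemma isProbabilityMeasure_sequenceModel {p : ℕ} (n : ℕ) (σ : ℝ) (θ : Fin p → ℝ) :
    IsProbabilityMeasure (sequenceModel n σ θ) := by
  unfold sequenceModel
  infer_instance

lemma measurable_lambdaHat {p : ℕ} (n s : ℕ) :
    Measurable (lambdaHat n s : (Fin p → ℝ) → ℝ) := by
  unfold lambdaHat sigmaSqHat
  fun_prop

/-- The expected bias at a coordinate that inherits its proxy from a fold position `j` before it.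
The fit need not be measurable, so the bound goes through a measurable majorant. -/
lemma exists_majorant_bias {p s n : ℕ} {σ : ℝ} (hsp : s < p) (hn : 1 ≤ n) (hσ : 0 < σ)
    {θ : Fin p → ℝ} (hθ : Antitone fun i => θ i ^ 2) (hθ0 : ∀ i : Fin p, s ≤ i.val → θ i = 0)
    {I : Finset (Fin p)} (hI : ∀ i ∈ I, i.val < s) {v : (Fin p → ℝ) → Fin p → EReal}
    (hv : ∀ y, IsIsotonicFit s I (varianceProxy n s y) (v y))
    {i j : Fin p} (hj : j ∈ I) (hji : j ≤ i) :
    ∃ G : (Fin p → ℝ) → ENNReal, Measurable G ∧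
      (∀ y, ENNReal.ofReal ((1 - shrinkFactor (v y j) (lambdaHat n s y)) * θ i ^ 2) ≤ G y) ∧
      ∫⁻ y, G y ∂(sequenceModel n σ θ) ≤ ENNReal.ofReal (184 * (σ ^ 2 / n)) := by
  have hn' : (0 : ℝ) < n := by exact_mod_cast hn
  have hl : 0 < σ ^ 2 / n := by positivity
  have := isProbabilityMeasure_sequenceModel n σ θ
  by_cases hsmall : θ j ^ 2 ≤ 48 * (σ ^ 2 / n)
  · refine ⟨fun _ => ENNReal.ofReal (184 * (σ ^ 2 / n)), measurable_const, fun y => ?_, by simp⟩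
    refine ENNReal.ofReal_le_ofReal ?_
    have h0 := shrinkFactor_nonneg (v y j) (lambdaHat_nonneg n hsp y)
    have h1 : θ i ^ 2 ≤ θ j ^ 2 := hθ hji
    nlinarith [sq_nonneg (θ i)]
  · refine ⟨fun y => ENNReal.ofReal (4 * lambdaHat n s y) +
      ENNReal.ofReal (θ j ^ 2 * windowPenalty I j (θ j ^ 2) (σ ^ 2 / n) θ y), ?_, fun y => ?_, ?_⟩
    · exact ((measurable_lambdaHat n s).const_mul 4).ennreal_ofReal.add
        ((measurable_windowPenalty _ _ _ _ _).const_mul _).ennreal_ofReal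
    · beta_reduce
      rw [← ENNReal.ofReal_add (mul_nonneg (by norm_num) (lambdaHat_nonneg n hsp y))
        (mul_nonneg (sq_nonneg _) (windowPenalty_nonneg _ _ _ _ _ _))]
      exact ENNReal.ofReal_le_ofReal
        (one_sub_shrinkFactor_mul_sq_le hl hsp hθ (hv y) hI hj hji)
    · rw [lintegral_add_left ((measurable_lambdaHat n s).const_mul 4).ennreal_ofReal]
      simp_rw [ENNReal.ofReal_mul (show (0 : ℝ) ≤ 4 by norm_num)]
      rw [lintegral_const_mul _ (measurable_lambdaHat n s).ennreal_ofReal,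
        lintegral_lambdaHat hsp hn hθ0, ← ENNReal.ofReal_mul (by norm_num)]
      refine (add_le_add_right (mul_lintegral_windowPenalty_le hn hσ θ I j
        (not_le.1 hsmall).le) _).trans ?_
      rw [← ENNReal.ofReal_add (by positivity) (by positivity)]
      exact ENNReal.ofReal_le_ofReal (by linarith)

/-- The risk of a shrunk coordinate is of the order of the noise level. The two cases are the first
position, whose proxy is at least `R`, and a position that inherits its proxy from the fold. -/
lemma exists_majorant_sq_error {p s n : ℕ} {σ R : ℝ} (hsp : s < p) (hn : 1 ≤ n) (hσ : 0 < σ)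
    {θ : Fin p → ℝ} (hθ : Antitone fun i => θ i ^ 2) (hθ0 : ∀ i : Fin p, s ≤ i.val → θ i = 0)
    (hR : ∀ i : Fin p, i.val = 0 → θ i ^ 2 ≤ R)
    {I : Finset (Fin p)} (hI : ∀ i ∈ I, i.val < s) {v : (Fin p → ℝ) → Fin p → EReal}
    (hv : ∀ y, IsIsotonicFit s I (varianceProxy n s y) (v y) ∧ IsUpperExtension s I R (v y))
    {i : Fin p} (his : i.val < s) (hiI : i ∉ I) (hprev : ∀ j : Fin p, j.val + 1 = i.val → j ∈ I) :
    ∃ G : (Fin p → ℝ) → ENNReal, Measurable G ∧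
      (∀ y, ENNReal.ofReal ((shrinkFactor (v y i) (lambdaHat n s y) * y i - θ i) ^ 2) ≤ G y) ∧
      ∫⁻ y, G y ∂(sequenceModel n σ θ) ≤ ENNReal.ofReal (185 * (σ ^ 2 / n)) := by
  have hn' : (0 : ℝ) < n := by exact_mod_cast hn
  have hl : 0 < σ ^ 2 / n := by positivity
  obtain ⟨G, hGm, hG, hGi⟩ : ∃ G : (Fin p → ℝ) → ENNReal, Measurable G ∧
      (∀ y, ENNReal.ofReal ((1 - shrinkFactor (v y i) (lambdaHat n s y)) * θ i ^ 2) ≤ G y) ∧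
      ∫⁻ y, G y ∂(sequenceModel n σ θ) ≤ ENNReal.ofReal (184 * (σ ^ 2 / n)) := by
    by_cases hi0 : i.val = 0
    · refine ⟨fun y => ENNReal.ofReal (4 * lambdaHat n s y),
        ((measurable_lambdaHat n s).const_mul 4).ennreal_ofReal, fun y => ?_, ?_⟩
      · refine ENNReal.ofReal_le_ofReal (one_sub_shrinkFactor_mul_le (lambdaHat_nonneg n hsp y)
          (sq_nonneg _) (le_trans ?_ (((hv y).2 i his hiI).1 hi0)))
        have h1 := hR i hi0
        exact_mod_cast (by linarith [sq_nonneg (θ i)] : θ i ^ 2 / 4 ≤ R)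
      · simp_rw [ENNReal.ofReal_mul (show (0 : ℝ) ≤ 4 by norm_num)]
        rw [lintegral_const_mul _ (measurable_lambdaHat n s).ennreal_ofReal,
          lintegral_lambdaHat hsp hn hθ0, ← ENNReal.ofReal_mul (by norm_num)]
        exact ENNReal.ofReal_le_ofReal (by linarith)
    · have hji : (i.val - 1) + 1 = i.val := by omega
      set j : Fin p := ⟨i.val - 1, by omega⟩ with hj
      have hvij : ∀ y, v y i = v y j := fun y => ((hv y).2 i his hiI).2 j hji
      simp_rw [hvij]
      exact exists_majorant_bias hsp hn hσ hθ hθ0 hI (fun y => (hv y).1) (hprev j hji)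
        (Fin.le_def.2 (Nat.sub_le _ _))
  refine ⟨fun y => ENNReal.ofReal ((y i - θ i) ^ 2) + G y, by fun_prop, fun y => ?_, ?_⟩
  · have h0 := shrinkFactor_nonneg (v y i) (lambdaHat_nonneg n hsp y)
    have h1 := shrinkFactor_le_one (v y i) (lambdaHat_nonneg n hsp y)
    refine le_trans (ENNReal.ofReal_le_ofReal (shrink_sq_error_le h0 h1 (y i) (θ i))) ?_
    exact ENNReal.ofReal_add_le.trans (add_le_add_right (hG y) _)
  · rw [lintegral_add_left (by fun_prop), lintegral_sq_sub_sequenceModel]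
    refine (add_le_add_right hGi _).trans ?_
    rw [← ENNReal.ofReal_add (by positivity) (by positivity)]
    exact ENNReal.ofReal_le_ofReal (by linarith)

/-! ### The risk bound -/

lemma antitone_sq_of_mem_sparseOrderedClass {p s : ℕ} {R : ℝ} {θ : Fin p → ℝ}
    (h : θ ∈ sparseOrderedClass p s R) : Antitone fun i => θ i ^ 2 := by
  obtain ⟨k, _, hmono, _, hzero⟩ := h
  intro i j hij
  by_cases hj : j.val < k
  · exact hmono i j hij hj
  · simpa [hzero j (not_lt.1 hj)] using sq_nonneg (θ i)

/-- On the ordered class the risk is at most a multiple of `s * σ ^ 2 / n`. -/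
lemma lintegral_crossFitEstimator_le {p s n : ℕ} {R σ : ℝ} (hsp : s < p) (hn : 1 ≤ n) (hσ : 0 < σ)
    {v₁ v₂ : (Fin p → ℝ) → Fin p → EReal}
    (hv₁ : ∀ y, IsIsotonicFit s (evenFold p s) (varianceProxy n s y) (v₁ y) ∧
      IsUpperExtension s (evenFold p s) R (v₁ y))
    (hv₂ : ∀ y, IsIsotonicFit s (oddFold p s) (varianceProxy n s y) (v₂ y) ∧
      IsUpperExtension s (oddFold p s) R (v₂ y))
    {θ : Fin p → ℝ} (hθ : θ ∈ sparseOrderedClass p s R) :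
    ∫⁻ y, ENNReal.ofReal (∑ i, (crossFitEstimator n s v₁ v₂ y i - θ i) ^ 2)
        ∂(sequenceModel n σ θ) ≤ ENNReal.ofReal (185 * s * (σ ^ 2 / n)) := by
  have hanti := antitone_sq_of_mem_sparseOrderedClass hθ
  obtain ⟨k, hks, _, hR, hzero⟩ := hθ
  have hθ0 : ∀ i : Fin p, s ≤ i.val → θ i = 0 := fun i hi => hzero i (hks.trans hi)
  have hmaj : ∀ i : Fin p, ∃ G : (Fin p → ℝ) → ENNReal, Measurable G ∧
      (∀ y, ENNReal.ofReal ((crossFitEstimator n s v₁ v₂ y i - θ i) ^ 2) ≤ G y) ∧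
      ∫⁻ y, G y ∂(sequenceModel n σ θ) ≤
        if i.val < s then ENNReal.ofReal (185 * (σ ^ 2 / n)) else 0 := by
    intro i
    by_cases his : i.val < s
    · simp only [his, if_true]
      by_cases hodd : Odd (i.val + 1)
      · have h1 : i ∈ oddFold p s := by simp [oddFold, his, hodd]
        have h2 : i ∉ evenFold p s := by
          simp [evenFold, his, Nat.not_even_iff_odd.2 hodd]
        simp only [crossFitEstimator, h1, if_true]
        refine exists_majorant_sq_error hsp hn hσ hanti hθ0 hR ?_ hv₁ his h2 fun j hj => ?_
        · intro l hl
          exact (Finset.mem_filter.1 hl).2.1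
        · refine Finset.mem_filter.2 ⟨Finset.mem_univ _, by omega, ?_⟩
          rw [hj]
          grind
      · have h1 : i ∉ oddFold p s := by simp only [oddFold, Finset.mem_filter, hodd]; simp
        have heven := Nat.not_odd_iff_even.1 hodd
        have h2 : i ∈ evenFold p s := by
          simp only [evenFold, Finset.mem_filter]; exact ⟨Finset.mem_univ _, his, heven⟩
        simp only [crossFitEstimator, h1, h2, if_true, if_false]
        refine exists_majorant_sq_error hsp hn hσ hanti hθ0 hR ?_ hv₂ his h1 fun j hj => ?_
        · intro l hl
          exact (Finset.mem_filter.1 hl).2.1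
        · refine Finset.mem_filter.2 ⟨Finset.mem_univ _, by omega, ?_⟩
          rw [hj]
          grind
    · have h1 : i ∉ oddFold p s := fun h => his (Finset.mem_filter.1 h).2.1
      have h2 : i ∉ evenFold p s := fun h => his (Finset.mem_filter.1 h).2.1
      refine ⟨0, measurable_zero, fun y => ?_, by simp⟩
      simp [crossFitEstimator, h1, h2, hθ0 i (not_lt.1 his)]
  choose G hGm hG hGi using hmaj
  calc ∫⁻ y, ENNReal.ofReal (∑ i, (crossFitEstimator n s v₁ v₂ y i - θ i) ^ 2)
        ∂(sequenceModel n σ θ)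
      ≤ ∫⁻ y, ∑ i, G i y ∂(sequenceModel n σ θ) := by
        refine lintegral_mono fun y => ?_
        rw [ENNReal.ofReal_sum_of_nonneg fun _ _ => sq_nonneg _]
        exact Finset.sum_le_sum fun i _ => hG i y
    _ = ∑ i, ∫⁻ y, G i y ∂(sequenceModel n σ θ) := lintegral_finsetSum _ fun i _ => hGm i
    _ ≤ ∑ i : Fin p, if i.val < s then ENNReal.ofReal (185 * (σ ^ 2 / n)) else 0 :=
        Finset.sum_le_sum fun i _ => hGi i
    _ = ENNReal.ofReal (185 * s * (σ ^ 2 / n)) := by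
        rw [← Finset.sum_filter, Finset.sum_const, Fin.card_filter_val_lt, min_eq_right hsp.le,
          nsmul_eq_mul, ← ENNReal.ofReal_natCast, ← ENNReal.ofReal_mul (Nat.cast_nonneg _)]
        congr 1
        ring

theorem theoremB1 :
    ∃ C : ℝ, 0 < C ∧
      ∀ (p s n : ℕ) (R σ : ℝ), 1 ≤ s → s < p → 1 ≤ n → 0 < σ → σ ^ 2 / n ≤ R →
      ∀ v₁ v₂ : (Fin p → ℝ) → Fin p → EReal,
        (∀ y, IsIsotonicFit s (evenFold p s) (varianceProxy n s y) (v₁ y) ∧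
          IsUpperExtension s (evenFold p s) R (v₁ y)) →
        (∀ y, IsIsotonicFit s (oddFold p s) (varianceProxy n s y) (v₂ y) ∧
          IsUpperExtension s (oddFold p s) R (v₂ y)) →
        (⨆ θ ∈ sparseOrderedClass p s R,
          ∫⁻ y, ENNReal.ofReal (∑ i, (crossFitEstimator n s v₁ v₂ y i - θ i) ^ 2)
            ∂(sequenceModel n σ θ)) ≤
        ENNReal.ofReal
          (C * s * (σ ^ 2 / n) * Real.log (Real.exp 1 * p / s) * Real.log (1 + R * n / σ ^ 2)
            + C * (σ ^ 2 / n + s * R / (p - s))) := by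
  refine ⟨370, by norm_num, ?_⟩
  intro p s n R σ hs hsp hn hσ hR v₁ v₂ hv₁ hv₂
  have hn' : (0 : ℝ) < n := by exact_mod_cast hn
  have hs' : (0 : ℝ) < s := by exact_mod_cast hs
  have hsp' : (s : ℝ) < p := by exact_mod_cast hsp
  have hps : (0 : ℝ) < (p : ℝ) - s := sub_pos.2 hsp'
  have hl : 0 < σ ^ 2 / n := by positivity
  have hR0 : 0 < R := hl.trans_le hR
  refine iSup₂_le fun θ hθ => (lintegral_crossFitEstimator_le hsp hn hσ hv₁ hv₂ hθ).trans ?_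
  refine ENNReal.ofReal_le_ofReal ?_
  -- The logarithmic factors are bounded below by `1` and `log 2`.
  have hlog1 : 1 ≤ Real.log (Real.exp 1 * p / s) := by
    have hp0 := hs'.trans hsp'
    rw [Real.le_log_iff_exp_le (by positivity), le_div_iff₀ hs']
    exact mul_le_mul_of_nonneg_left hsp'.le (Real.exp_pos 1).le
  have hlog2 : 1 / 2 ≤ Real.log (1 + R * n / σ ^ 2) := by
    have h1 : 1 ≤ R * n / σ ^ 2 := by
      rw [le_div_iff₀ (by positivity), one_mul]
      exact (div_le_iff₀ hn').1 hR
    have h2 := Real.log_le_log (by norm_num) (by linarith : (2 : ℝ) ≤ 1 + R * n / σ ^ 2)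
    linarith [Real.log_two_gt_d9]
  have hprod : 1 / 2 ≤ Real.log (Real.exp 1 * p / s) * Real.log (1 + R * n / σ ^ 2) := by
    nlinarith
  have hrest : 0 ≤ 370 * (σ ^ 2 / n + s * R / (p - s)) := by
    have := div_nonneg (mul_nonneg hs'.le hR0.le) hps.le
    linarith
  have hmain := mul_le_mul_of_nonneg_left hprod (by positivity : 0 ≤ 370 * s * (σ ^ 2 / n))
  linarith
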